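/- Let $\mathbf{U}$ and $\mathbf{U}^+$ be universes with $\mathbf{U} \in \mathbf{U}^+$, and let $\kappa$ be a regular cardinal in $\mathbf{U}$. For a universe $\mathbf{V}$ (either $\mathbf{U}$ or $\mathbf{U}^+$), an object $A$ of a category is called $(\kappa, \mathbf{V})$-compact if $\mathrm{Hom}(A, -)$ preserves colimits of $\mathbf{V}$-small $\kappa$-filtered diagrams. A $\kappa$-accessible $\mathbf{V}$-category is a locally $\mathbf{V}$-small category that has colimits of all $\mathbf{V}$-small $\kappa$-filtered diagrams and for which there is a $\mathbf{V}$-set of $(\kappa, \mathbf{V})$-compact objects such that every object is a colimit of a $\mathbf{V}$-small $\kappa$-filtered diagram of objects in that set. A locally $\kappa$-presentable $\mathbf{V}$-category is a $\kappa$-accessible $\mathbf{V}$-category that has colimits of all $\mathbf{V}$-small diagrams. A functor whose domain is a $\kappa$-accessible $\mathbf{V}$-category is $(\kappa, \mathbf{V})$-accessible if it preserves colimits of $\mathbf{V}$-small $\kappa$-filtered diagrams. A $(\kappa, \mathbf{U}, \mathbf{U}^+)$-accessible extension is a $(\kappa, \mathbf{U})$-accessible functor $i : \mathcal{C} \to \mathcal{C}^+$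 from a $\kappa$-accessible $\mathbf{U}$-category to a $\kappa$-accessible $\mathbf{U}^+$-category that sends $(\kappa, \mathbf{U})$-compact objects to $(\kappa, \mathbf{U}^+)$-compact objects and such that the functor so induced, from the full subcategory of $(\kappa, \mathbf{U})$-compact objects of $\mathcal{C}$ to the full subcategory of $(\kappa, \mathbf{U}^+)$-compact objects of $\mathcal{C}^+$, is fully faithful and essentially surjective on objects. Suppose that $\mathcal{C}$ and $\mathcal{D}$ are locally $\kappa$-presentable $\mathbf{U}$-categories, that $\mathcal{C}^+$ and $\mathcal{D}^+$ are locally $\kappa$-presentable $\mathbf{U}^+$-categories, and that $i : \mathcal{C} \to \mathcal{C}^+$ and $j : \mathcal{D} \to \mathcal{D}^+$ are $(\kappa, \mathbf{U}, \mathbf{U}^+)$-accessible extensions. Let $G : \mathcal{D} \to \mathcal{C}$ be a $(\kappa, \mathbf{U})$-accessible functor and let $G^+ : \mathcal{D}^+ \to \mathcal{C}^+$ be a $(\kappa, \mathbf{U}^+)$-accessible functor such that the square formed by $G$, $G^+$, $i$ and $j$ commutes strictly, i.e. $G^+ j = i G$. If $G$ and $G^+$ have left adjoints, $F \dashv G$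 and $F^+ \dashv G^+$, then the square satisfies the left Beck–Chevalley condition: the mate of the identity $i G = G^+ j$, that is, the natural transformation $$F^+ i \xrightarrow{F^+ i \eta} F^+ i G F = F^+ G^+ j F \xrightarrow{\epsilon^+ j F} j F,$$ where $\eta$ is the unit of $F \dashv G$ and $\epsilon^+$ is the counit of $F^+ \dashv G^+$, is a natural isomorphism. -/

import Mathlib

open CategoryTheory

universe w w' v₁ v₂ v₃ v₄ u₁ u₂ u₃ u₄

namespace AccessibleExtension

/-- A regular cardinal remains regular when it is regarded as a cardinal of a larger universe. -/
instance fact_isRegular_lift (κ : Cardinal.{w}) [hκ : Fact κ.IsRegular] :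
    Fact (Cardinal.lift.{w', w} κ).IsRegular :=
  ⟨hκ.out.lift⟩

section Extension

variable {C : Type u₁} [Category.{v₁} C] {C' : Type u₂} [Category.{v₂} C']

/-- If `i : C ⥤ C'` sends `κ`-presentable objects (relative to the universe `w`) to `κ`-presentable
objects (relative to the universe `max w w'`), this is the functor that `i` induces between the full
subcategories of these objects. -/
def presentableFunctor (κ : Cardinal.{w}) [Fact κ.IsRegular] (i : C ⥤ C')
    (hi : ∀ X : C, IsCardinalPresentable X κ →
      IsCardinalPresentable (i.obj X) (Cardinal.lift.{w', w} κ)) :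
    (isCardinalPresentable C κ).FullSubcategory ⥤
      (isCardinalPresentable C' (Cardinal.lift.{w', w} κ)).FullSubcategory :=
  (isCardinalPresentable C' (Cardinal.lift.{w', w} κ)).lift
    ((isCardinalPresentable C κ).ι ⋙ i) (fun X => hi X.obj X.property)

/-- For universes `U = Type w` and `U⁺ = Type (max w w')` (so that `U ⊆ U⁺`) and a regular cardinal
`κ` in `U`, a functor `i : C ⥤ C'` is a `(κ, U, U⁺)`-accessible extension if `C` is a `κ`-accessible
`U`-category, `C'` is a `κ`-accessible `U⁺`-category, `i` preserves colimits of `U`-small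
`κ`-filtered diagrams, `i` sends `(κ, U)`-presentable objects to `(κ, U⁺)`-presentable objects, and
the functor so induced between the full subcategories of these objects is fully faithful and
essentially surjective. -/
structure IsAccessibleExtension (κ : Cardinal.{w}) [Fact κ.IsRegular] (i : C ⥤ C') : Prop where
  accessible_source : IsCardinalAccessibleCategory C κ
  accessible_target : IsCardinalAccessibleCategory C' (Cardinal.lift.{w', w} κ)
  accessible : i.IsCardinalAccessible κ
  presentable_obj : ∀ X : C, IsCardinalPresentable X κ →
    IsCardinalPresentable (i.obj X) (Cardinal.lift.{w', w} κ)
  full : (presentableFunctor.{w, w'} κ i presentable_obj).Full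
  faithful : (presentableFunctor.{w, w'} κ i presentable_obj).Faithful
  essSurj : (presentableFunctor.{w, w'} κ i presentable_obj).EssSurj

end Extension

section BeckChevalley

variable {C : Type u₁} [Category.{v₁} C] {C' : Type u₂} [Category.{v₂} C']
  {D : Type u₃} [Category.{v₃} D] {D' : Type u₄} [Category.{v₄} D']

/-- The mate of `α : H G ⟹ G' K` with respect to `F ⊣ G` and `F' ⊣ G'`, that is,
`ε' K F ∘ F' α F ∘ F' H η : F' H ⟹ K F`. -/
def mate {G : D ⥤ C} {F : C ⥤ D} {G' : D' ⥤ C'} {F' : C' ⥤ D'} (adj : F ⊣ G) (adj' : F' ⊣ G')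
    {H : C ⥤ C'} {K : D ⥤ D'} (α : G ⋙ H ⟶ K ⋙ G') : H ⋙ F' ⟶ F ⋙ K :=
  ((mateEquiv adj adj').symm (TwoSquare.mk G K H G' α)).natTrans

/-- The explicit formula for the components of the mate. -/
theorem mate_app {G : D ⥤ C} {F : C ⥤ D} {G' : D' ⥤ C'} {F' : C' ⥤ D'} (adj : F ⊣ G)
    (adj' : F' ⊣ G') {H : C ⥤ C'} {K : D ⥤ D'} (α : G ⋙ H ⟶ K ⋙ G') (X : C) :
    (mate adj adj' α).app X =
      F'.map (H.map (adj.unit.app X)) ≫ F'.map (α.app (F.obj X)) ≫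
        adj'.counit.app (K.obj (F.obj X)) := by
  simp [mate, TwoSquare.natTrans]

/-- A square of functors that commutes up to a natural isomorphism `α : H G ≅ G' K`, where `F ⊣ G`
and `F' ⊣ G'`, satisfies the left Beck–Chevalley condition if the mate of `α` is also a natural
isomorphism. -/
def LeftBeckChevalley {G : D ⥤ C} {F : C ⥤ D} {G' : D' ⥤ C'} {F' : C' ⥤ D'} (adj : F ⊣ G)
    (adj' : F' ⊣ G') {H : C ⥤ C'} {K : D ⥤ D'} (α : G ⋙ H ≅ K ⋙ G') : Prop :=
  IsIso (mate adj adj' α.hom)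

end BeckChevalley

end AccessibleExtension

/-! Left adjoints preserve colimits and `i`, `j` are `κ`-accessible, so `i ⋙ F'` and `F ⋙ j`
preserve `U`-small `κ`-filtered colimits. Every object of `C` is such a colimit of `κ`-presentable
ones, so it suffices to invert the mate at a `κ`-presentable `X`
(`isIso_of_isCardinalFilteredGenerator`). There `F X` and `F' (i X)` are presentable, because `G`
and `G'` are accessible. Extensions are bijective on morphisms out of presentable objects
(`map_bijective`), so precomposition with the mate identifies with `Hom(F X, B) ≃ Hom(X, G B) ≃
Hom(i X, i (G B)) ≃ Hom(i X, G' (j B)) ≃ Hom(F' (i X), j B)`. As `F' (i X)` is itself isomorphic to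
some `j B`, a Yoneda argument concludes (`isIso_mate_app`). -/

namespace AccessibleExtension

open Limits

section Universes

variable {C : Type u₁} [Category.{v₁} C] {C' : Type u₂} [Category.{v₂} C']

/-- A `κ`-filtered category is also filtered for `κ` regarded as a cardinal of a larger
universe. -/
lemma isCardinalFiltered_lift (J : Type u₃) [Category.{v₃} J] (κ : Cardinal.{w})
    [Fact κ.IsRegular] [IsCardinalFiltered J κ] :
    IsCardinalFiltered J (Cardinal.lift.{w', w} κ) where
  nonempty_cocone F hA :=
    ⟨IsCardinalFiltered.cocone (κ := κ) F ((hasCardinalLT_lift_iff _ _).1 hA)⟩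

lemma essentiallySmall_of_smallCategory (J : Type w) [SmallCategory J] :
    EssentiallySmall.{max w w'} J :=
  have : LocallySmall.{max w w'} J := ⟨fun _ _ ↦ inferInstance⟩
  essentiallySmall_of_small_of_locallySmall.{max w w'} J

/-- A functor that is accessible relative to a larger universe is accessible relative to a
smaller one. -/
lemma isCardinalAccessible_of_lift (F : C ⥤ C') (κ : Cardinal.{w}) [Fact κ.IsRegular]
    [F.IsCardinalAccessible (Cardinal.lift.{w', w} κ)] : F.IsCardinalAccessible κ where
  preservesColimitOfShape J _ _ := by
    have := isCardinalFiltered_lift.{w, w'} J κ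
    have : EssentiallySmall.{max w w'} J := essentiallySmall_of_smallCategory.{w, w'} J
    exact F.preservesColimitsOfShape_of_isCardinalAccessible_of_essentiallySmall
      (Cardinal.lift.{w', w} κ) J

/-- A natural transformation between `κ`-accessible functors on a category with a generating
class `P` of `κ`-presentable objects is invertible if it is invertible on `P`. -/
lemma isIso_of_isCardinalFilteredGenerator {κ : Cardinal.{w}} [Fact κ.IsRegular]
    {P : ObjectProperty C} (hP : P.IsCardinalFilteredGenerator κ) {F G : C ⥤ C'}
    [F.IsCardinalAccessible κ] [G.IsCardinalAccessible κ] (τ : F ⟶ G)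
    (hτ : ∀ X, P X → IsIso (τ.app X)) : IsIso τ := by
  refine (NatTrans.isIso_iff_isIso_app τ).2 fun X ↦ ?_
  obtain ⟨J, _, _, ⟨p⟩⟩ := hP.exists_colimitsOfShape X
  have := F.preservesColimitsOfShape_of_isCardinalAccessible κ J
  have := G.preservesColimitsOfShape_of_isCardinalAccessible κ J
  have (k : J) : IsIso ((Functor.whiskerLeft p.diag τ).app k) := hτ _ (p.prop_diag_obj k)
  have : IsIso (Functor.whiskerLeft p.diag τ) := NatIso.isIso_of_isIso_app _
  exact isIso_app_coconePt_of_preservesColimit _ τ _ p.isColimit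

end Universes

namespace IsAccessibleExtension

variable {C : Type u₁} [Category.{v₁} C] {C' : Type u₂} [Category.{v₂} C']
  {κ : Cardinal.{w}} [Fact κ.IsRegular] {i : C ⥤ C'}

lemma map_bijective_of_presentable (hi : IsAccessibleExtension.{w, w'} κ i) (X Y : C)
    (hX : IsCardinalPresentable X κ) (hY : IsCardinalPresentable Y κ) :
    Function.Bijective (i.map : (X ⟶ Y) → (i.obj X ⟶ i.obj Y)) := by
  have := hi.full
  have := hi.faithful
  let X₀ : (isCardinalPresentable C κ).FullSubcategory := ⟨X, hX⟩
  let Y₀ : (isCardinalPresentable C κ).FullSubcategory := ⟨Y, hY⟩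
  let Φ := presentableFunctor.{w, w'} κ i hi.presentable_obj
  constructor
  · intro f g h
    have : ObjectProperty.homMk f = (ObjectProperty.homMk g : X₀ ⟶ Y₀) :=
      Φ.map_injective (ObjectProperty.hom_ext _ h)
    exact congr_arg (fun f ↦ f.hom) this
  · intro f
    obtain ⟨g, hg⟩ := Φ.map_surjective (ObjectProperty.homMk f : Φ.obj X₀ ⟶ Φ.obj Y₀)
    exact ⟨g.hom, congr_arg (fun f ↦ f.hom) hg⟩

/-- An accessible extension is fully faithful on morphisms out of a `κ`-presentable object. -/
lemma map_bijective (hi : IsAccessibleExtension.{w, w'} κ i) (X Y : C)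
    (hX : IsCardinalPresentable X κ) :
    Function.Bijective (i.map : (X ⟶ Y) → (i.obj X ⟶ i.obj Y)) := by
  have := hi.accessible_source
  obtain ⟨P, _, hP⟩ := HasCardinalFilteredGenerator.exists_generator C κ
  obtain ⟨J, _, _, ⟨p⟩⟩ := hP.exists_colimitsOfShape Y
  have hp (k : J) : IsCardinalPresentable (p.diag.obj k) κ :=
    hP.le_isCardinalPresentable _ (p.prop_diag_obj k)
  have := hi.accessible
  have := i.preservesColimitsOfShape_of_isCardinalAccessible κ J
  -- The diagram for `Y` is `U`-small, so presentability of `i X` relative to `U` is what applies to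
  -- its image under `i`.
  have hiX : IsCardinalPresentable (i.obj X) κ := by
    have := hi.presentable_obj X hX
    exact isCardinalAccessible_of_lift.{w, w'} _ κ
  have : EssentiallySmall.{w} J := essentiallySmall_of_smallCategory.{w, w} J
  have hc := isColimitOfPreserves i p.isColimit
  constructor
  · intro f g h
    obtain ⟨k, f, rfl⟩ := IsCardinalPresentable.exists_hom_of_isColimit κ p.isColimit f
    obtain ⟨l, g, rfl⟩ := IsCardinalPresentable.exists_hom_of_isColimit κ p.isColimit g
    -- The images under `i` already agree at a stage `m`, whose object is presentable, so
    -- faithfulness on presentable objects applies there.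
    obtain ⟨m, u, v, huv⟩ := IsCardinalPresentable.exists_eq_of_isColimit κ hc
      (i.map f) (i.map g) (by simpa using h)
    have := (hi.map_bijective_of_presentable X _ hX (hp m)).1
      (a₁ := f ≫ p.diag.map u) (a₂ := g ≫ p.diag.map v) (by simpa using huv)
    dsimp
    rw [← p.cocone.w u, ← p.cocone.w v, reassoc_of% this]
  · intro f
    obtain ⟨k, g, hg⟩ := IsCardinalPresentable.exists_hom_of_isColimit κ hc f
    obtain ⟨g, rfl⟩ := (hi.map_bijective_of_presentable X _ hX (hp k)).2 g
    exact ⟨g ≫ p.cocone.ι.app k, by simpa using hg⟩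

lemma exists_iso (hi : IsAccessibleExtension.{w, w'} κ i) (Z : C')
    (hZ : IsCardinalPresentable Z (Cardinal.lift.{w', w} κ)) :
    ∃ X : C, IsCardinalPresentable X κ ∧ Nonempty (i.obj X ≅ Z) := by
  have := hi.essSurj
  let Φ := presentableFunctor.{w, w'} κ i hi.presentable_obj
  let Z₀ : (isCardinalPresentable C' (Cardinal.lift.{w', w} κ)).FullSubcategory := ⟨Z, hZ⟩
  exact ⟨_, (Φ.objPreimage Z₀).property,
    ⟨(isCardinalPresentable C' (Cardinal.lift.{w', w} κ)).ι.mapIso (Φ.objObjPreimageIso Z₀)⟩⟩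

end IsAccessibleExtension

section BeckChevalley

variable {C : Type u₁} [Category.{v₁} C] {C' : Type u₂} [Category.{v₂} C']
  {D : Type u₃} [Category.{v₃} D] {D' : Type u₄} [Category.{v₄} D']

/-- The transpose of the mate, composed with the image of a morphism. -/
lemma homEquiv_mate_app_comp {G : D ⥤ C} {F : C ⥤ D} {G' : D' ⥤ C'} {F' : C' ⥤ D'}
    (adj : F ⊣ G) (adj' : F' ⊣ G') {H : C ⥤ C'} {K : D ⥤ D'} (α : G ⋙ H ⟶ K ⋙ G')
    {X : C} {B : D} (h : F.obj X ⟶ B) :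
    adj'.homEquiv _ _ ((mate adj adj' α).app X ≫ K.map h) =
      H.map (adj.homEquiv _ _ h) ≫ α.app B := by
  have := α.naturality h
  dsimp at this
  rw [← Equiv.eq_symm_apply, mate_app, Adjunction.homEquiv_counit, Adjunction.homEquiv_unit]
  simp [this]

variable {κ : Cardinal.{w}} [Fact κ.IsRegular]

/-- Over a `κ`-presentable object, the mate of an isomorphism is invertible. -/
lemma isIso_mate_app {i : C ⥤ C'} (hi : IsAccessibleExtension.{w, w'} κ i)
    {j : D ⥤ D'} (hj : IsAccessibleExtension.{w, w'} κ j)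
    {G : D ⥤ C} [G.IsCardinalAccessible κ]
    {G' : D' ⥤ C'} [G'.IsCardinalAccessible (Cardinal.lift.{w', w} κ)]
    {F : C ⥤ D} (adj : F ⊣ G) {F' : C' ⥤ D'} (adj' : F' ⊣ G')
    (α : G ⋙ i ≅ j ⋙ G') (X : C) (hX : IsCardinalPresentable X κ) :
    IsIso ((mate adj adj' α.hom).app X) := by
  have hFX : IsCardinalPresentable (F.obj X) κ :=
    adj.isCardinalPresentable_leftAdjoint_obj κ X
  have := hi.presentable_obj X hX
  have hF'X : IsCardinalPresentable (F'.obj (i.obj X)) (Cardinal.lift.{w', w} κ) :=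
    adj'.isCardinalPresentable_leftAdjoint_obj _ _
  have key (B : D) : Function.Bijective
      (fun g : j.obj (F.obj X) ⟶ j.obj B ↦ (mate adj adj' α.hom).app X ≫ g) := by
    -- Restrict to morphisms in the image of `j` and transpose across `adj'`; neither changes
    -- bijectivity.
    rw [← Function.Bijective.of_comp_iff _ (hj.map_bijective (F.obj X) B hFX),
      ← Function.Bijective.of_comp_iff' (adj'.homEquiv _ _).bijective]
    have : (adj'.homEquiv (i.obj X) (j.obj B)) ∘
        (fun g : j.obj (F.obj X) ⟶ j.obj B ↦ (mate adj adj' α.hom).app X ≫ g) ∘ j.map =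
        (α.app B).homToEquiv ∘ i.map ∘ (adj.homEquiv X B) :=
      funext fun h ↦ homEquiv_mate_app_comp adj adj' α.hom h
    rw [this]
    exact (Equiv.bijective _).comp
      ((hi.map_bijective X (G.obj B) hX).comp (Equiv.bijective _))
  obtain ⟨B, _, ⟨e⟩⟩ := hj.exists_iso _ hF'X
  -- Surjectivity at `B` makes `r ≫ e.hom` a one-sided inverse of the mate; injectivity at `F X`
  -- gives the other identity.
  obtain ⟨r, hr⟩ := (key B).2 e.inv
  dsimp at hr
  refine ⟨r ≫ e.hom, by simp [reassoc_of% hr], (key (F.obj X)).1 ?_⟩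
  simp [reassoc_of% hr]

end BeckChevalley

end AccessibleExtension

/-- The universes are `U = Type w` and `U⁺ = Type (max (w + 1) w')`, so that `U ∈ U⁺`. -/
theorem mainTheorem6
    (κ : Cardinal.{w}) [Fact κ.IsRegular]
    {C : Type u₁} [Category.{v₁} C] {C' : Type u₂} [Category.{v₂} C']
    {D : Type u₃} [Category.{v₃} D] {D' : Type u₄} [Category.{v₄} D']
    (_hC : IsCardinalLocallyPresentable C κ)
    (_hD : IsCardinalLocallyPresentable D κ)
    (_hC' : IsCardinalLocallyPresentable C' (Cardinal.lift.{max (w + 1) w', w} κ))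
    (_hD' : IsCardinalLocallyPresentable D' (Cardinal.lift.{max (w + 1) w', w} κ))
    (i : C ⥤ C') (_hi : AccessibleExtension.IsAccessibleExtension.{w, max (w + 1) w'} κ i)
    (j : D ⥤ D') (_hj : AccessibleExtension.IsAccessibleExtension.{w, max (w + 1) w'} κ j)
    (G : D ⥤ C) (_hG : G.IsCardinalAccessible κ)
    (G' : D' ⥤ C') (_hG' : G'.IsCardinalAccessible (Cardinal.lift.{max (w + 1) w', w} κ))
    (comm : j ⋙ G' = G ⋙ i)
    (F : C ⥤ D) (adj : F ⊣ G) (F' : C' ⥤ D') (adj' : F' ⊣ G') :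
    AccessibleExtension.LeftBeckChevalley adj adj' (eqToIso comm.symm) := by
  obtain ⟨P, _, hP⟩ := HasCardinalFilteredGenerator.exists_generator C κ
  have := _hi.accessible
  have := _hj.accessible
  have : F.IsCardinalAccessible κ :=
    ⟨fun _ _ _ ↦ adj.leftAdjoint_preservesColimits.preservesColimitsOfShape⟩
  have : F'.IsCardinalAccessible κ :=
    ⟨fun _ _ _ ↦ adj'.leftAdjoint_preservesColimits.preservesColimitsOfShape⟩
  exact AccessibleExtension.isIso_of_isCardinalFilteredGenerator hP _ fun X hX ↦
    AccessibleExtension.isIso_mate_app _hi _hj adj adj' (eqToIso comm.symm) X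
      (hP.le_isCardinalPresentable X hX)
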